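/- **Conventions.** Let $\Gamma$ be a finite connected simple graph and let $D(\Gamma)$ be its set of oriented edges. A *combinatorial embedding* of $\Gamma$ (into an orientable surface) is a pair $\Pi=(\Gamma,\rho)$, where $\rho$ is a permutation of $D(\Gamma)$ that, for each vertex $x$, permutes the oriented edges $(x,y)$ leaving $x$ in a single cycle. Embeddings of $\Gamma$ are *distinct* if their maps $\rho$ are different. The faces of $\Pi$ are the closed walks obtained by face tracing, i.e. the orbits of $(x,y)\mapsto\rho(y,x)$ on $D(\Gamma)$. The embedding is *$k$-gonal* if every face has length $k$, *simple* if every face is a cycle (no vertex and no edge is repeated along it), and a *biembedding* if the faces can be coloured with two colours so that the two faces along each edge have different colours. An automorphism $\sigma$ of $\Gamma$ is an *orientation-preserving automorphism* of $\Pi$ if $\sigma\circ\rho=\rho\circ\sigma$ on $D(\Gamma)$. Write $\mathcal H(m)$ for the number of derangements (fixed-point-free permutations) of a set of $m$ elements. **Theorem.** Let $t\ge 2$, $k=4t+3$ and $v=2nk+1$, where $n\equiv 1\pmod 4$ and $n\ge (7k+1)/3$; if $3\mid n$, assume also that $k\equiv 7\pmod{12}$. Let $K_v$ be the complete graph with vertex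 set $\mathbb Z_v$. Then there are at least $$2(n-2)\binom n2[\mathcal H(t-2)]^2$$ distinct simple $k$-gonal biembeddings of $K_v$ such that, for each of them and each $g\in\mathbb Z_v$, the translation $\tau_g\colon x\mapsto x+g$ is an orientation-preserving automorphism. Moreover $$2(n-2)\binom n2[\mathcal H(t-2)]^2\;\approx\;\frac{n^3[(t-2)!]^2}{e^2},$$ that is, the ratio of the two sides tends to $1$ as $t\to\infty$, uniformly over all $n$ such that $(n,t)$ satisfies the hypotheses above. -/

import Mathlib

open Filter Topology
open scoped Nat

/-- A combinatorial embedding of a (finite, connected) graph `G` into an orientable surface: a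
rotation `rot` of the oriented edges (darts) of `G` which, for each vertex `x`, permutes the darts
leaving `x` in a single cycle. Since `G` is simple, the darts leaving `x` are the neighbours of
`x`. Two combinatorial embeddings of `G` are equal exactly when their rotations are. -/
@[ext]
structure CombEmbedding {V : Type*} [Finite V] (G : SimpleGraph V) where
  /-- The rotation on the oriented edges. -/
  rot : Equiv.Perm G.Dart
  isCycleOn_rot : ∀ x : V, rot.IsCycleOn {d : G.Dart | d.fst = x}
  connected : G.Connected

namespace CombEmbedding

variable {V : Type*} [Finite V] {G : SimpleGraph V}

/-- Face tracing: having walked along `(x, y)`, turn around to `(y, x)` and continue with the next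
dart at `y` in the rotation. -/
def facePerm (E : CombEmbedding G) : Equiv.Perm G.Dart :=
  (Function.Involutive.toPerm SimpleGraph.Dart.symm SimpleGraph.Dart.symm_involutive).trans E.rot

/-- The faces of the embedding: the closed walks produced by face tracing, that is, the orbits
of the face permutation on the darts. Every edge lies on the face of each of its two darts. -/
def Face (E : CombEmbedding G) : Type _ :=
  Quotient (Equiv.Perm.SameCycle.setoid E.facePerm)

/-- The face whose boundary walk traverses the dart `d`. -/
def faceOf (E : CombEmbedding G) (d : G.Dart) : E.Face :=
  Quotient.mk (Equiv.Perm.SameCycle.setoid E.facePerm) d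

/-- The darts of the boundary walk of a face. -/
def boundary (E : CombEmbedding G) (F : E.Face) : Set G.Dart :=
  {d | E.faceOf d = F}

/-- All faces have length `k`, the length being the number of steps of the boundary walk. -/
def IsGonal (E : CombEmbedding G) (k : ℕ) : Prop :=
  ∀ F : E.Face, (E.boundary F).ncard = k

/-- All faces are simple: each boundary walk is a cycle of the graph, visiting no vertex and
traversing no edge twice. -/
def IsSimple (E : CombEmbedding G) : Prop :=
  ∀ F : E.Face,
    Set.InjOn (fun d : G.Dart => d.fst) (E.boundary F) ∧
    Set.InjOn (fun d : G.Dart => d.edge) (E.boundary F)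

/-- The embedding is face 2-colorable: the two sides of every edge get different colours. -/
def IsBiembedding (E : CombEmbedding G) : Prop :=
  ∃ c : E.Face → Bool, ∀ d : G.Dart, c (E.faceOf d) ≠ c (E.faceOf d.symm)

/-- A graph isomorphism `σ` is an orientation-preserving isomorphism of embeddings if
`σ ∘ ρ = ρ' ∘ σ` on oriented edges. -/
def IsOrientationPreservingIso {V' : Type*} [Finite V'] {G' : SimpleGraph V'}
    (E : CombEmbedding G) (E' : CombEmbedding G') (σ : G ≃g G') : Prop :=
  ∀ d : G.Dart, σ.toHom.mapDart (E.rot d) = E'.rot (σ.toHom.mapDart d)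

/-- An orientation-preserving automorphism of an embedding. -/
def IsOrientationPreservingAut (E : CombEmbedding G) (σ : G ≃g G) : Prop :=
  IsOrientationPreservingIso E E σ

end CombEmbedding

/-- The translation `x ↦ x + g` of `ℤ/v`, as a graph automorphism of the complete graph `K_v`. -/
def translation {v : ℕ} (g : ZMod v) :
    (⊤ : SimpleGraph (ZMod v)) ≃g (⊤ : SimpleGraph (ZMod v)) :=
  SimpleGraph.Iso.completeGraph (Equiv.addRight g)

/-- The hypotheses on the parameters `n, k, t`; here `2 ≤ t` makes `t - 2` a number of points. -/
def Admissible (n k t : ℕ) : Prop :=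
  2 ≤ t ∧ k = 4 * t + 3 ∧ n ≡ 1 [MOD 4] ∧ 7 * k + 1 ≤ 3 * n ∧ (3 ∣ n → k ≡ 7 [MOD 12])

/-- `2 (n - 2) * (n choose 2) * D(t - 2) ^ 2`, with `D(m)` the number of derangements of `m`
points. The subtractions are only used for `2 ≤ n` and `2 ≤ t`. -/
def biembeddingBound (n t : ℕ) : ℕ :=
  2 * (n - 2) * n.choose 2 * numDerangements (t - 2) ^ 2

/-! ### Translation-invariant embeddings of complete graphs -/

/-! A translation-invariant rotation of `K_v` is a cyclic permutation `ρ` of the nonzero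
displacements. It comes from a signed array with absolute values 1, …, nk, each used once, whose
cells are split into n rows and also into n columns of k cells, all of sum zero. Row entries, and
negated column entries, are the steps of 2n closed walks; each nonzero residue modulo v = 2nk + 1 is
then a step exactly once (`displacementEquiv`), and `a` and `-a` are steps of walks of different
kinds. The faces are the translates of these walks, coloured by kind (`cyclicEmbedding_faces`). Two
things remain: partial sums must be distinct, so that faces are cycles, and `ρ` must be a single
cycle.

A row has 2t pairs x, -(x + 1), each of sum -1, and then entries -top, mid, low with mid + low = top
+ 2t. Row l and column l share their first 4t + 1 cells. The other two absolute values are mid(l +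
1), low(l) in the row and low(l + 1), mid(l) in the column; both sums involve only `halfIndex n l +
halfIndex n (l + 1)`. Partial sums run through 0, -1, …, -2t at even positions up to 4t and are
positive at odd ones below 4t; the remaining two lie below -2t (`partialSum_injOn`). Column 0 lists
its last two cells in the opposite order, which joins three would-be cycles of `ρ` into one
(`rel_cells`).

All this survives any reordering of the pairs after the first in each row. The rotation remembers
the order (`pairOrder_eq_of_embedding_eq`), so there are at least ((2t - 1)!)^n embeddings, which
exceeds the bound (`biembeddingBound_le`). -/

/-- A dart of `K_v` is given by its first endpoint and its nonzero displacement. -/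
def dartEquiv (v : ℕ) :
    (⊤ : SimpleGraph (ZMod v)).Dart ≃ ZMod v × {a : ZMod v // a ≠ 0} where
  toFun d := (d.fst, ⟨d.snd - d.fst, sub_ne_zero.2 d.adj.ne'⟩)
  invFun p := ⟨(p.1, p.1 + p.2.1), by simpa using p.2.2⟩
  left_inv d := by ext <;> simp
  right_inv p := by ext <;> simp

/-- The embedding of `K_v` whose rotation at every vertex is `ρ` on displacements. -/
def cyclicEmbedding {v : ℕ} [NeZero v] (ρ : Equiv.Perm {a : ZMod v // a ≠ 0})
    (hρ : ∀ a b, ρ.SameCycle a b) : CombEmbedding (⊤ : SimpleGraph (ZMod v)) where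
  rot := (dartEquiv v).trans (((Equiv.refl _).prodCongr ρ).trans (dartEquiv v).symm)
  isCycleOn_rot x := by
    set τ := (dartEquiv v).trans (((Equiv.refl _).prodCongr ρ).trans (dartEquiv v).symm)
    have hfst : ∀ d, (τ d).fst = d.fst := fun d => rfl
    have h1 : ∀ a, τ ((dartEquiv v).symm (x, a)) = (dartEquiv v).symm (x, ρ a) := by
      intro a; simp [τ]
    have hz : ∀ (i : ℕ) (a : {a : ZMod v // a ≠ 0}),
        (τ ^ i) ((dartEquiv v).symm (x, a)) = (dartEquiv v).symm (x, (ρ ^ i) a) := by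
      intro i
      induction i with
      | zero => simp
      | succ i ih =>
        intro a
        rw [pow_succ', pow_succ', Equiv.Perm.mul_apply, Equiv.Perm.mul_apply, ih, h1]
    refine ⟨?_, ?_⟩
    · refine ⟨fun d hd => ?_, τ.injective.injOn, fun d hd => ⟨τ.symm d, ?_, by simp⟩⟩
      · exact (hfst d).trans hd
      · have := hfst (τ.symm d)
        rw [Equiv.apply_symm_apply] at this
        exact this.symm.trans hd
    · intro d hd d' hd'
      obtain ⟨i, hi⟩ := (hρ (dartEquiv v d).2 (dartEquiv v d').2).exists_nat_pow_eq
      refine ⟨i, ?_⟩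
      have e : ∀ d : (⊤ : SimpleGraph (ZMod v)).Dart, d.fst = x →
          d = (dartEquiv v).symm (x, (dartEquiv v d).2) := by
        rintro d rfl; exact ((dartEquiv v).symm_apply_apply d).symm
      rw [zpow_natCast, e d hd, hz, hi]
      exact (e d' hd').symm
  connected := SimpleGraph.connected_top

/-! ### Faces of a translation-invariant embedding -/

section cyclic
variable {v : ℕ}

theorem cyclicEmbedding_injective [NeZero v] {ρ ρ' : Equiv.Perm {a : ZMod v // a ≠ 0}}
    {h : ∀ a b, ρ.SameCycle a b} {h' : ∀ a b, ρ'.SameCycle a b}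
    (e : cyclicEmbedding ρ h = cyclicEmbedding ρ' h') : ρ = ρ' := by
  ext a
  have := congrArg (fun E : CombEmbedding (⊤ : SimpleGraph (ZMod v)) =>
    (dartEquiv v (E.rot ((dartEquiv v).symm (0, a)))).2.1) e
  simpa [cyclicEmbedding] using this

theorem cyclicEmbedding_translation [NeZero v] (ρ : Equiv.Perm {a : ZMod v // a ≠ 0})
    (h : ∀ a b, ρ.SameCycle a b) (g : ZMod v) :
    (cyclicEmbedding ρ h).IsOrientationPreservingAut (translation g) := by
  intro d
  ext
  · rfl
  · have : (⟨(d.snd + g) - (d.fst + g), by simp [sub_eq_zero]⟩ :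
        {a : ZMod v // a ≠ 0}) = ⟨d.snd - d.fst, sub_ne_zero.2 d.adj.ne'⟩ := by
      ext; simp
    change (d.fst + (ρ ⟨d.snd - d.fst, _⟩).1) + g = (d.fst + g) + (ρ ⟨(d.snd + g) - (d.fst + g), _⟩).1
    rw [this]; ring

/-- The rotation on displacements whose faces are the orbits of the shift in the second
coordinate, when the displacements are labelled through `θ`. -/
def facesRotation {B : Type*} {k : ℕ} (θ : B × ZMod k ≃ {a : ZMod v // a ≠ 0}) :
    Equiv.Perm {a : ZMod v // a ≠ 0} :=
  (Equiv.trans ⟨fun a => ⟨-a.1, neg_ne_zero.2 a.2⟩, fun a => ⟨-a.1, neg_ne_zero.2 a.2⟩,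
    fun a => by simp, fun a => by simp⟩ θ.symm).trans
    (((Equiv.refl B).prodCongr (Equiv.addRight (1 : ZMod k))).trans θ)

theorem facesRotation_apply {B : Type*} {k : ℕ} (θ : B × ZMod k ≃ {a : ZMod v // a ≠ 0})
    (a : {a : ZMod v // a ≠ 0}) (b : B) (s : ZMod k) (h : a.1 = -(θ (b, s)).1) :
    facesRotation θ a = θ (b, s + 1) := by
  have : (⟨-a.1, neg_ne_zero.2 a.2⟩ : {a : ZMod v // a ≠ 0}) = θ (b, s) := by
    ext; simp [h]
  simp [facesRotation, this]

variable {B : Type*} {k : ℕ} (θ : B × ZMod k ≃ {a : ZMod v // a ≠ 0}) (Q : B → ZMod k → ZMod v)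

/-- Coordinates of darts: a translate of a base face, and a position along it. -/
def faceCoord : (⊤ : SimpleGraph (ZMod v)).Dart ≃ (ZMod v × B) × ZMod k where
  toFun d := ((d.fst - Q (θ.symm (dartEquiv v d).2).1 (θ.symm (dartEquiv v d).2).2,
    (θ.symm (dartEquiv v d).2).1), (θ.symm (dartEquiv v d).2).2)
  invFun p := (dartEquiv v).symm (p.1.1 + Q p.1.2 p.2, θ (p.1.2, p.2))
  left_inv d := by
    apply (dartEquiv v).injective
    simp only [Equiv.apply_symm_apply, Prod.mk.eta, sub_add_cancel]
    rfl
  right_inv p := by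
    have : ((dartEquiv v).symm (p.1.1 + Q p.1.2 p.2, θ (p.1.2, p.2))).fst =
      p.1.1 + Q p.1.2 p.2 := rfl
    simp [this]

/-- Seen from its far end, a dart of displacement `θ (b, s)` has the opposite displacement, which
the rotation sends to `θ (b, s + 1)`. As `θ` is the difference of `Q`, the translate `y` does not
change. -/
theorem facePerm_faceCoord_symm [NeZero v] (h : ∀ a b, (facesRotation θ).SameCycle a b)
    (hQ : ∀ b s, (θ (b, s)).1 = Q b (s + 1) - Q b s) (p : (ZMod v × B) × ZMod k) :
    (cyclicEmbedding (facesRotation θ) h).facePerm ((faceCoord θ Q).symm p) =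
      (faceCoord θ Q).symm (p.1, p.2 + 1) := by
  obtain ⟨⟨y, b⟩, s⟩ := p
  apply (dartEquiv v).injective
  have e' : dartEquiv v ((faceCoord θ Q).symm ((y, b), s + 1)) =
      (y + Q b (s + 1), θ (b, s + 1)) := (dartEquiv v).apply_symm_apply _
  rw [e']
  have h3 : dartEquiv v ((faceCoord θ Q).symm ((y, b), s)).symm =
      (y + Q b (s + 1), ⟨-(θ (b, s)).1, neg_ne_zero.2 (θ (b, s)).2⟩) := by
    have f1 : ((faceCoord θ Q).symm ((y, b), s)).fst = y + Q b s := rfl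
    have f2 : ((faceCoord θ Q).symm ((y, b), s)).snd = y + Q b s + (θ (b, s)).1 := rfl
    ext
    · change ((faceCoord θ Q).symm ((y, b), s)).snd = _
      rw [f2]
      simp [hQ]
    · change ((faceCoord θ Q).symm ((y, b), s)).fst - ((faceCoord θ Q).symm ((y, b), s)).snd = _
      rw [f1, f2]; simp
  change dartEquiv v ((dartEquiv v).symm (((Equiv.refl _).prodCongr (facesRotation θ))
    (dartEquiv v ((faceCoord θ Q).symm ((y, b), s)).symm))) = _
  rw [h3, Equiv.apply_symm_apply]
  simp only [Equiv.prodCongr_apply, Prod.map_apply, Equiv.refl_apply]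
  rw [facesRotation_apply θ ⟨-(θ (b, s)).1, neg_ne_zero.2 (θ (b, s)).2⟩ b s rfl]

theorem sameCycle_facePerm_iff [NeZero v] [NeZero k] (h : ∀ a b, (facesRotation θ).SameCycle a b)
    (hQ : ∀ b s, (θ (b, s)).1 = Q b (s + 1) - Q b s)
    (d d' : (⊤ : SimpleGraph (ZMod v)).Dart) :
    (cyclicEmbedding (facesRotation θ) h).facePerm.SameCycle d d' ↔
      (faceCoord θ Q d).1 = (faceCoord θ Q d').1 := by
  set τ := (cyclicEmbedding (facesRotation θ) h).facePerm
  have step : ∀ d, faceCoord θ Q (τ d) = ((faceCoord θ Q d).1, (faceCoord θ Q d).2 + 1) := by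
    intro d
    have := facePerm_faceCoord_symm θ Q h hQ (faceCoord θ Q d)
    rw [Equiv.symm_apply_apply] at this
    change τ d = _ at this
    rw [this, Equiv.apply_symm_apply]
  have steps : ∀ (i : ℕ) d, faceCoord θ Q ((τ ^ i) d) =
      ((faceCoord θ Q d).1, (faceCoord θ Q d).2 + i) := by
    intro i
    induction i with
    | zero => simp
    | succ i ih => intro d; rw [pow_succ', Equiv.Perm.mul_apply, step, ih]; simp [add_assoc]
  constructor
  · intro hs
    have : Finite ((⊤ : SimpleGraph (ZMod v)).Dart) := Finite.of_equiv _ (dartEquiv v).symm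
    obtain ⟨i, rfl⟩ := hs.exists_nat_pow_eq
    rw [steps]
  · intro he
    refine ⟨(((faceCoord θ Q d').2 - (faceCoord θ Q d).2).val : ℕ), ?_⟩
    apply (faceCoord θ Q).injective
    rw [zpow_natCast, steps, he]
    ext <;> simp

/-- Each face is a translate of a closed walk `Q b`, so its length and its vertices are read off `Q
b`. The two sides of an edge carry opposite displacements, hence the condition on `c`. -/
theorem cyclicEmbedding_faces [NeZero v] [NeZero k] (h : ∀ a b, (facesRotation θ).SameCycle a b)
    (hQ : ∀ b s, (θ (b, s)).1 = Q b (s + 1) - Q b s) (hinj : ∀ b, Function.Injective (Q b))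
    (c : B → Bool) (hc : ∀ b s b' s', (θ (b, s)).1 = -(θ (b', s')).1 → c b ≠ c b') :
    (cyclicEmbedding (facesRotation θ) h).IsGonal k ∧
      (cyclicEmbedding (facesRotation θ) h).IsSimple ∧
      (cyclicEmbedding (facesRotation θ) h).IsBiembedding := by
  set E := cyclicEmbedding (facesRotation θ) h
  have hface : ∀ d d', E.faceOf d = E.faceOf d' ↔ (faceCoord θ Q d).1 = (faceCoord θ Q d').1 := by
    intro d d'
    rw [← sameCycle_facePerm_iff θ Q h hQ]
    exact Quotient.eq (r := Equiv.Perm.SameCycle.setoid E.facePerm)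
  have hsurj : ∀ F : E.Face, ∃ d, E.faceOf d = F := Quotient.exists_rep
  have hcol : ∀ d : (⊤ : SimpleGraph (ZMod v)).Dart,
      c (faceCoord θ Q d).1.2 ≠ c (faceCoord θ Q d.symm).1.2 := by
    intro d
    refine hc _ (faceCoord θ Q d).2 _ (faceCoord θ Q d.symm).2 ?_
    have e : ∀ d, θ ((faceCoord θ Q d).1.2, (faceCoord θ Q d).2) = (dartEquiv v d).2 :=
      fun d => θ.apply_symm_apply _
    rw [e, e]
    change d.snd - d.fst = -(d.fst - d.snd)
    ring
  refine ⟨fun F => ?_, fun F => ?_, ?_⟩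
  · obtain ⟨d₀, rfl⟩ := hsurj F
    have : E.boundary (E.faceOf d₀) =
        Set.range fun s : ZMod k => (faceCoord θ Q).symm ((faceCoord θ Q d₀).1, s) := by
      ext d
      rw [CombEmbedding.boundary, Set.mem_ofPred_eq, hface]
      constructor
      · intro hd
        exact ⟨(faceCoord θ Q d).2, by simp [← hd]⟩
      · rintro ⟨s, rfl⟩
        simp
    rw [this, Set.ncard_eq_toFinset_card', Set.toFinset_range, Finset.card_image_of_injective,
      Finset.card_univ, ZMod.card]
    intro s s' hs
    simpa using hs
  · obtain ⟨d₀, rfl⟩ := hsurj F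
    have h1 : Set.InjOn (fun d : (⊤ : SimpleGraph (ZMod v)).Dart => d.fst)
        (E.boundary (E.faceOf d₀)) := by
      intro d hd d' hd' he
      rw [CombEmbedding.boundary, Set.mem_ofPred_eq, hface] at hd hd'
      have e : ∀ d, d.fst = (faceCoord θ Q d).1.1 +
          Q (faceCoord θ Q d).1.2 (faceCoord θ Q d).2 := by
        intro d; simp [faceCoord]
      change d.fst = d'.fst at he
      rw [e d, e d', hd, hd'] at he
      apply (faceCoord θ Q).injective
      exact Prod.ext (hd.trans hd'.symm) (hinj _ (add_left_cancel he))
    refine ⟨h1, ?_⟩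
    intro d hd d' hd' he
    rcases (SimpleGraph.dart_edge_eq_iff d d').1 he with h2 | h2
    · exact h2
    -- Opposite darts lie on faces of different colours, so one face cannot contain both.
    · exfalso
      rw [CombEmbedding.boundary, Set.mem_ofPred_eq, hface] at hd hd'
      apply hcol d'
      rw [← h2, hd, hd']
  · refine ⟨Quotient.lift (fun d => c (faceCoord θ Q d).1.2) ?_, hcol⟩
    intro d d' hd
    have := (sameCycle_facePerm_iff θ Q h hQ d d').1 hd
    simp only [this]

end cyclic

/-! ### The entries -/

/-- The least nonnegative residue of `(n / 2) * l` modulo `n`. -/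
def halfIndex (n : ℕ) (l : ZMod n) : ℕ := (((n / 2 : ℕ) : ZMod n) * l).val

/-- Thus `n / 2` acts as -1/2 modulo `n`, and `halfIndex n l` represents -l/2. -/
theorem two_mul_half_cast {n : ℕ} (hn : n % 2 = 1) : 2 * ((n / 2 : ℕ) : ZMod n) = -1 := by
  have h : ((2 * (n / 2) + 1 : ℕ) : ZMod n) = 0 := by
    rw [show 2 * (n / 2) + 1 = n by omega]; simp
  push_cast at h
  exact eq_neg_of_add_eq_zero_left h

section entries
variable {n : ℕ} [NeZero n]

theorem halfIndex_cast (l : ZMod n) : (halfIndex n l : ZMod n) = ((n / 2 : ℕ) : ZMod n) * l :=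
  ZMod.natCast_zmod_val _

theorem halfIndex_lt (l : ZMod n) : halfIndex n l < n := ZMod.val_lt _

theorem halfIndex_injective (hn : n % 2 = 1) : Function.Injective (halfIndex n) := by
  intro l l' h
  have h1 := congrArg (fun x : ℕ => (2 : ZMod n) * (x : ZMod n)) h
  simp only [halfIndex_cast, ← mul_assoc, two_mul_half_cast hn] at h1
  simpa using h1

theorem halfIndex_add_injective (hn : n % 2 = 1) :
    Function.Injective fun l : ZMod n => halfIndex n l + halfIndex n (l + 1) := by
  intro l l' h
  have h1 := congrArg (fun x : ℕ => (x : ZMod n)) h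
  simp only [Nat.cast_add, halfIndex_cast] at h1
  linear_combination -h1 + (l - l') * two_mul_half_cast hn

/-- The second term is the first plus `n / 2`, reduced by `n` if necessary. The range holds exactly
`n` integers, so the top entries fit into an interval of length `n`. -/
theorem halfIndex_add_mem (hn : n % 2 = 1) (l : ZMod n) :
    n / 2 ≤ halfIndex n l + halfIndex n (l + 1) ∧
      halfIndex n l + halfIndex n (l + 1) ≤ 3 * (n / 2) := by
  have h : halfIndex n (l + 1) = (halfIndex n l + n / 2) % n := by
    rw [halfIndex, mul_add, mul_one, ZMod.val_add, ZMod.val_natCast, Nat.add_mod_mod, halfIndex]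
  have h2 := halfIndex_lt l
  rw [h]
  rcases lt_or_ge (halfIndex n l + n / 2) n with h3 | h3
  · rw [Nat.mod_eq_of_lt h3]; omega
  · rw [Nat.mod_eq_sub_mod h3, Nat.mod_eq_of_lt (by omega)]; omega

end entries

/-- The smaller element of the `g`-th pair of consecutive numbers. The numbers
`n / 2 + 2 t + 1, …, n / 2 + 2 t + 3 n` are left out. -/
def pairStart (n t g : ℕ) : ℕ := if 2 * g + 1 ≤ n / 2 + 2 * t then 2 * g + 1 else 2 * g + 1 + 3 * n

/-- An element of the first of the three intervals of length `n` which avoid all pairs. -/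
def lowEntry (n t : ℕ) (l : ZMod n) : ℕ := n / 2 + 2 * t + 1 + halfIndex n l

/-- An element of the second of the three intervals of length `n` which avoid all pairs. -/
def midEntry (n t : ℕ) (l : ZMod n) : ℕ := n / 2 + 2 * t + 1 + n + halfIndex n l

/-- An element of the third of the three intervals of length `n` which avoid all pairs. -/
def topEntry (n t : ℕ) (l : ZMod n) : ℕ :=
  2 * (n / 2) + 2 * t + 2 + n + (halfIndex n l + halfIndex n (l + 1))

/-- The start of the `j`-th pair in row `l`, if this row uses its pairs in the order `F l`. -/
def rowPair (n t : ℕ) (F : ZMod n → ℕ → ℕ) (l : ZMod n) (j : ℕ) : ℕ :=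
  pairStart n t (n * F l j + l.val)

/-- The absolute value of the entry in position `s` of row `l`. -/
def absEntry (n t : ℕ) (F : ZMod n → ℕ → ℕ) (l : ZMod n) (s : ℕ) : ℕ :=
  if s < 4 * t then rowPair n t F l (s / 2) + s % 2
  else if s = 4 * t then topEntry n t l
  else if s = 4 * t + 1 then midEntry n t (l + 1)
  else lowEntry n t l

/-- The entry in position `s` of row `l`. -/
def entry (n t : ℕ) (F : ZMod n → ℕ → ℕ) (l : ZMod n) (s : ℕ) : ℤ :=
  if s < 4 * t ∧ s % 2 = 1 ∨ s = 4 * t then -(absEntry n t F l s : ℤ) else absEntry n t F l s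

/-- For each `l`, `F l` permutes `0, …, 2 t - 1` and fixes `0`. -/
structure IsPairOrder {n : ℕ} (t : ℕ) (F : ZMod n → ℕ → ℕ) : Prop where
  zero : ∀ l, F l 0 = 0
  lt : ∀ l j, j < 2 * t → F l j < 2 * t
  inj : ∀ l i j, i < 2 * t → j < 2 * t → F l i = F l j → i = j

/-- For `n` congruent to 1 modulo 4, `n / 2 + 2 * t` is even, so no pair straddles the lower end of
the gap. -/
theorem pairStart_lt_or_gt (n t g : ℕ) (hn : n % 4 = 1) :
    pairStart n t g + 1 ≤ n / 2 + 2 * t ∨ n / 2 + 2 * t + 3 * n + 1 ≤ pairStart n t g := by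
  unfold pairStart; split_ifs <;> omega

theorem pairStart_add_two_le (n t : ℕ) {g g' : ℕ} (h : g < g') :
    pairStart n t g + 2 ≤ pairStart n t g' := by
  unfold pairStart; split_ifs <;> omega

theorem pairStart_add_injective (n t : ℕ) {g g' e e' : ℕ} (he : e < 2) (he' : e' < 2)
    (h : pairStart n t g + e = pairStart n t g' + e') : g = g' ∧ e = e' := by
  rcases lt_trichotomy g g' with h1 | h1 | h1
  · have := pairStart_add_two_le n t h1; omega
  · subst h1; omega
  · have := pairStart_add_two_le n t h1; omega

theorem mul_add_eq_mul_add_iff_of_lt {n a b i j : ℕ} (hi : i < n) (hj : j < n)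
    (h : n * a + i = n * b + j) : a = b ∧ i = j := by
  have h1 := congrArg (· % n) h
  simp only [Nat.mul_add_mod, Nat.mod_eq_of_lt hi, Nat.mod_eq_of_lt hj] at h1
  subst h1
  exact ⟨Nat.eq_of_mul_eq_mul_left (by omega) (Nat.add_right_cancel h), rfl⟩

/-! ### Distinctness and range of the absolute values -/

section injectivity
variable {n t : ℕ} [NeZero n] {F : ZMod n → ℕ → ℕ}

theorem absEntry_injective (hn : n % 4 = 1) (hF : IsPairOrder t F) {l l' : ZMod n} {s s' : ℕ}
    (hs : s < 4 * t + 3) (hs' : s' < 4 * t + 3) (h : absEntry n t F l s = absEntry n t F l' s') :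
    l = l' ∧ s = s' := by
  have pair := fun (l : ZMod n) (j : ℕ) => pairStart_lt_or_gt n t (n * F l j + l.val) hn
  have hlt := fun l : ZMod n => halfIndex_lt l
  have hmem := fun l : ZMod n => halfIndex_add_mem (n := n) (by omega) l
  simp only [absEntry] at h
  unfold rowPair lowEntry midEntry topEntry at h
  by_cases c1 : s < 4 * t
  · by_cases d1 : s' < 4 * t
    · rw [if_pos c1, if_pos d1] at h
      obtain ⟨h1, h2⟩ := pairStart_add_injective n t (by omega) (by omega) h
      obtain ⟨h3, h4⟩ := mul_add_eq_mul_add_iff_of_lt (ZMod.val_lt l) (ZMod.val_lt l') h1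
      have h5 := ZMod.val_injective n h4
      subst h5
      have := hF.inj l _ _ (by omega) (by omega) h3
      exact ⟨rfl, by omega⟩
    · exfalso
      rw [if_pos c1, if_neg d1] at h
      have := pair l (s / 2); have := hlt l'; have := hlt (l' + 1); have := hmem l'
      split_ifs at h <;> omega
  · by_cases d1 : s' < 4 * t
    · exfalso
      rw [if_neg c1, if_pos d1] at h
      have := pair l' (s' / 2); have := hlt l; have := hlt (l + 1); have := hmem l
      split_ifs at h <;> omega
    · rw [if_neg c1, if_neg d1] at h
      have a1 := hlt l; have a2 := hlt (l + 1); have a3 := hmem l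
      have b1 := hlt l'; have b2 := hlt (l' + 1); have b3 := hmem l'
      split_ifs at h with e1 e2 e3 e4 e5 e6 e7 e8
      · exact ⟨halfIndex_add_injective (by omega) (by simpa using h), by omega⟩
      · omega
      · omega
      · omega
      · exact ⟨add_right_cancel (halfIndex_injective (by omega) (by omega : halfIndex n (l + 1) =
          halfIndex n (l' + 1))), by omega⟩
      · omega
      · omega
      · omega
      · exact ⟨halfIndex_injective (by omega) (by omega), by omega⟩

theorem rowPair_add_one_le (hF : IsPairOrder t F) (l : ZMod n) {j : ℕ} (hj : j < 2 * t) :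
    rowPair n t F l j + 1 ≤ n * (4 * t + 3) := by
  have h1 := hF.lt l j hj
  have h2 := ZMod.val_lt l
  have h3 : n * F l j + n ≤ n * (2 * t) := by
    rw [← Nat.mul_succ]; exact Nat.mul_le_mul_left _ h1
  have h4 : n * (4 * t + 3) = 2 * (n * (2 * t)) + 3 * n := by ring
  unfold rowPair pairStart
  split_ifs <;> omega

omit [NeZero n] in
theorem half_add_le (hn : n % 4 = 1) (ht : 1 ≤ t) (h : 28 * t + 22 ≤ 3 * n) :
    n / 2 + 4 * t + 3 * n ≤ n * (4 * t + 3) := by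
  have : n * (4 * t + 3) = n * (4 * t) + 3 * n := by ring
  have : n * 4 ≤ n * (4 * t) := Nat.mul_le_mul_left _ (by omega)
  omega

theorem absEntry_mem (hn : n % 4 = 1) (ht : 1 ≤ t) (hnt : 28 * t + 22 ≤ 3 * n)
    (hF : IsPairOrder t F) (l : ZMod n) (s : ℕ) :
    1 ≤ absEntry n t F l s ∧ absEntry n t F l s ≤ n * (4 * t + 3) := by
  have h0 := half_add_le hn ht hnt
  have a1 := halfIndex_lt l
  have a2 := halfIndex_lt (l + 1)
  have a3 := halfIndex_add_mem (n := n) (by omega) l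
  unfold absEntry lowEntry midEntry topEntry
  split_ifs with h1
  · have h2 := rowPair_add_one_le hF l (j := s / 2) (by omega)
    have h3 : 1 ≤ rowPair n t F l (s / 2) := by unfold rowPair pairStart; split_ifs <;> omega
    omega
  all_goals omega

end injectivity

/-! ### Partial sums -/

/-- The partial sums of `x 0, -(x 0 + 1), …, x (2 t - 1), -(x (2 t - 1) + 1), -r, 2 t + r - y, y`. -/
def partialSum (t : ℕ) (x : ℕ → ℕ) (r y s : ℕ) : ℤ :=
  if s ≤ 4 * t then (if s % 2 = 0 then -((s / 2 : ℕ) : ℤ) else x (s / 2) - ((s / 2 : ℕ) : ℤ))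
  else if s = 4 * t + 1 then -(2 * t) - r else -y

section partialSum
variable {t : ℕ} (x : ℕ → ℕ) (r y : ℕ)

theorem partialSum_even {s : ℕ} (h : s ≤ 4 * t) (h2 : s % 2 = 0) :
    partialSum t x r y s = -((s / 2 : ℕ) : ℤ) := by
  unfold partialSum; rw [if_pos h, if_pos h2]

theorem partialSum_odd {s : ℕ} (h : s ≤ 4 * t) (h2 : s % 2 = 1) :
    partialSum t x r y s = x (s / 2) - ((s / 2 : ℕ) : ℤ) := by
  unfold partialSum; rw [if_pos h, if_neg (by omega)]

theorem partialSum_four_mul_add_one : partialSum t x r y (4 * t + 1) = -(2 * t) - r := by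
  unfold partialSum; rw [if_neg (by omega), if_pos rfl]

theorem partialSum_four_mul_add_two : partialSum t x r y (4 * t + 2) = -y := by
  unfold partialSum; rw [if_neg (by omega), if_neg (by omega)]

end partialSum

/-- The wrap to position 0 expresses that the walk closes: the pairs contribute -2t, which the last
three entries cancel. -/
theorem partialSum_step (t : ℕ) (x : ℕ → ℕ) (r y : ℕ) {s : ℕ} (hs : s < 4 * t + 3) :
    partialSum t x r y (if s + 1 = 4 * t + 3 then 0 else s + 1) - partialSum t x r y s =
      if s < 4 * t then (if s % 2 = 0 then (x (s / 2) : ℤ) else -(x (s / 2) + 1 : ℤ))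
      else if s = 4 * t then -r else if s = 4 * t + 1 then 2 * t + r - y else y := by
  have h : s < 4 * t ∨ s = 4 * t ∨ s = 4 * t + 1 ∨ s = 4 * t + 2 := by omega
  rcases h with h | rfl | rfl | rfl
  · rw [if_neg (by omega), if_pos h]
    rcases Nat.mod_two_eq_zero_or_one s with h2 | h2
    · rw [if_pos h2, partialSum_even x r y h.le h2, partialSum_odd x r y (by omega) (by omega),
        show (s + 1) / 2 = s / 2 by omega]
      ring
    · rw [if_neg (by omega), partialSum_odd x r y h.le h2,
        partialSum_even x r y (s := s + 1) (by omega) (by omega),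
        show (s + 1) / 2 = s / 2 + 1 by omega]
      push_cast; ring
  · rw [if_neg (by omega), if_neg (by omega), if_pos rfl,
      partialSum_even x r y (s := 4 * t) le_rfl (by omega), partialSum_four_mul_add_one,
      show 4 * t / 2 = 2 * t by omega]
    push_cast; ring
  · rw [if_neg (by omega), if_neg (by omega), if_neg (by omega), if_pos rfl,
      partialSum_four_mul_add_one, partialSum_four_mul_add_two]
    ring
  · rw [if_pos rfl, if_neg (by omega), if_neg (by omega), if_neg (by omega),
      partialSum_even x r y (s := 0) (by omega) rfl, partialSum_four_mul_add_two]
    simp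

/-- The values split into [-2t, 0] at even positions, positive ones at odd positions, and -2t - r <
-y < -2t. The shift of `x i` by `i` is harmless since the `x i` are more than 2t apart. The first
pair is exempt from a lower bound above 2t because its shift is 0; this is why a small pair has to
come first. -/
theorem partialSum_injOn (t : ℕ) (x : ℕ → ℕ) (r y : ℕ) (ht : 1 ≤ t) (h0 : 0 < x 0)
    (hx : ∀ i < 2 * t, i ≠ 0 → x 0 + 2 * t < x i)
    (hxx : ∀ i < 2 * t, ∀ j < 2 * t, i ≠ 0 → j ≠ 0 → i ≠ j →
      x i + 2 * t < x j ∨ x j + 2 * t < x i)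
    (hy : 2 * t < y) (hr : y ≤ r) :
    Set.InjOn (partialSum t x r y) {s | s < 4 * t + 3} := by
  intro s hs s' hs' h
  simp only [Set.mem_ofPred_eq] at hs hs'
  have pos : ∀ i < 2 * t, (i : ℤ) < x i := by
    intro i hi
    rcases Nat.eq_zero_or_pos i with rfl | h1
    · exact_mod_cast h0
    · have := hx i hi (by omega); omega
  have lt : ∀ i < 2 * t, ∀ j < 2 * t, i ≠ j → (x i : ℤ) - i ≠ x j - j := by
    intro i hi j hj hij
    rcases Nat.eq_zero_or_pos i with rfl | h1
    · have := hx j hj (by omega); omega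
    · rcases Nat.eq_zero_or_pos j with rfl | h2
      · have := hx i hi (by omega); omega
      · have := hxx i hi j hj (by omega) (by omega) hij; omega
  unfold partialSum at h
  by_cases c : s ≤ 4 * t
  · by_cases d : s' ≤ 4 * t
    · rw [if_pos c, if_pos d] at h
      split_ifs at h with e1 e2 e3
      · omega
      · have := pos (s' / 2) (by omega); omega
      · have := pos (s / 2) (by omega); omega
      · by_contra hne
        exact lt (s / 2) (by omega) (s' / 2) (by omega) (by omega) h
    · exfalso
      rw [if_pos c, if_neg d] at h
      split_ifs at h with e1 e2 e3
      · omega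
      · omega
      · have := pos (s / 2) (by omega); omega
      · have := pos (s / 2) (by omega); omega
  · by_cases d : s' ≤ 4 * t
    · exfalso
      rw [if_neg c, if_pos d] at h
      split_ifs at h with e1 e2 e3
      · omega
      · have := pos (s' / 2) (by omega); omega
      · omega
      · have := pos (s' / 2) (by omega); omega
    · rw [if_neg c, if_neg d] at h
      split_ifs at h <;> omega

theorem partialSum_mem (t : ℕ) (x : ℕ → ℕ) (r y N : ℕ) (hN : ∀ i < 2 * t, x i ≤ N)
    (hx : ∀ i < 2 * t, 0 < x i) (hr : y ≤ r) (s : ℕ) :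
    -((2 * t + r : ℕ) : ℤ) ≤ partialSum t x r y s ∧ partialSum t x r y s ≤ N := by
  unfold partialSum
  split_ifs with h1 h2
  · omega
  · have := hN (s / 2) (by omega); have := hx (s / 2) (by omega); omega
  · omega
  · omega

/-- The last entry of column `l`. -/
def columnLast (n t : ℕ) (l : ZMod n) : ℕ := if l = 0 then lowEntry n t 1 else midEntry n t l

/-! ### Rows and columns as closed walks -/

section rows
variable {n t : ℕ} [NeZero n] {F : ZMod n → ℕ → ℕ}

omit [NeZero n] in
theorem rowPair_pos (l : ZMod n) (j : ℕ) : 0 < rowPair n t F l j := by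
  unfold rowPair pairStart; split_ifs <;> omega

omit [NeZero n] in
theorem rowPair_large (hnt : 28 * t + 22 ≤ 3 * n) (hF : IsPairOrder t F) (l : ZMod n) {i : ℕ}
    (hi : i < 2 * t) (h0 : i ≠ 0) :
    rowPair n t F l i = 2 * (n * F l i + l.val) + 1 + 3 * n ∧ n ≤ n * F l i := by
  have h1 : 1 ≤ F l i := by
    by_contra h
    exact h0 (hF.inj l i 0 hi (by omega) (by rw [hF.zero l]; omega))
  have h2 : n ≤ n * F l i := Nat.le_mul_of_pos_right n h1
  refine ⟨?_, h2⟩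
  unfold rowPair pairStart
  rw [if_neg (by omega)]

theorem partialSum_rowPair_injective (hn : n % 4 = 1) (ht : 1 ≤ t) (hnt : 28 * t + 22 ≤ 3 * n)
    (hF : IsPairOrder t F) (l : ZMod n) {y : ℕ} (hy : 2 * t < y) (hr : y ≤ topEntry n t l)
    {s s' : ℕ} (hs : s < 4 * t + 3) (hs' : s' < 4 * t + 3)
    (h : (partialSum t (rowPair n t F l) (topEntry n t l) y s : ZMod (2 * n * (4 * t + 3) + 1)) =
      partialSum t (rowPair n t F l) (topEntry n t l) y s') : s = s' := by
  have hinj := partialSum_injOn t (rowPair n t F l) (topEntry n t l) y ht (rowPair_pos l 0)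
    (by
      intro i hi h0
      obtain ⟨h1, h2⟩ := rowPair_large hnt hF l hi h0
      have : rowPair n t F l 0 ≤ 2 * l.val + 1 + 3 * n := by
        unfold rowPair pairStart; rw [hF.zero]; split_ifs <;> omega
      omega)
    (by
      intro i hi j hj h0 h0' hij
      obtain ⟨h1, -⟩ := rowPair_large hnt hF l hi h0
      obtain ⟨h2, -⟩ := rowPair_large hnt hF l hj h0'
      have h3 : ∀ a b : ℕ, a < b → n * a + n ≤ n * b := by
        intro a b hab; rw [← Nat.mul_succ]; exact Nat.mul_le_mul_left _ hab
      rcases lt_trichotomy (F l i) (F l j) with h4 | h4 | h4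
      · have := h3 _ _ h4; omega
      · exact absurd (hF.inj l i j hi hj h4) hij
      · have := h3 _ _ h4; omega) hy hr
  apply hinj hs hs'
  have mem := partialSum_mem t (rowPair n t F l) (topEntry n t l) y (n * (4 * t + 3))
    (fun i hi => by have := rowPair_add_one_le hF l hi; omega) (fun i _ => rowPair_pos l i) hr
  have m1 := mem s
  have m2 := mem s'
  have h3 := half_add_le hn ht hnt
  have h4 : topEntry n t l ≤ n / 2 + 2 * t + 3 * n := by
    have := halfIndex_add_mem (n := n) (by omega) l
    unfold topEntry; omega
  rw [ZMod.intCast_eq_intCast_iff_dvd_sub, mul_assoc] at h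
  generalize n * (4 * t + 3) = N at *
  -- Both values lie in [-N, N], so they differ by less than the modulus 2N + 1.
  have := Int.eq_zero_of_abs_lt_dvd h (by rw [abs_lt]; constructor <;> omega)
  omega

theorem lowEntry_mem (hn : n % 4 = 1) (l l' : ZMod n) :
    2 * t < lowEntry n t l' ∧ lowEntry n t l' ≤ topEntry n t l := by
  have := halfIndex_add_mem (n := n) (by omega) l
  have := halfIndex_lt l'
  unfold lowEntry topEntry; omega

theorem columnLast_mem (hn : n % 4 = 1) (l : ZMod n) :
    2 * t < columnLast n t l ∧ columnLast n t l ≤ topEntry n t l := by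
  unfold columnLast
  split_ifs with h
  · exact lowEntry_mem hn _ _
  · have := halfIndex_add_mem (n := n) (by omega) l
    have := halfIndex_lt l
    unfold midEntry topEntry; omega

/-- The cell in position `s` of column `l`, given as a position in a row. -/
def columnCell (n t : ℕ) (l : ZMod n) (s : ℕ) : ZMod n × ℕ :=
  if s ≤ 4 * t then (l, s)
  else if s = 4 * t + 1 then (if l = 0 then (-1, 4 * t + 1) else (l + 1, 4 * t + 2))
  else (if l = 0 then (1, 4 * t + 2) else (l - 1, 4 * t + 1))

omit [NeZero n] in
theorem columnCell_lt (l : ZMod n) {s : ℕ} (hs : s < 4 * t + 3) :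
    (columnCell n t l s).2 < 4 * t + 3 := by
  unfold columnCell; split_ifs <;> simp_all

omit [NeZero n] in
theorem columnCell_injective {l l' : ZMod n} {s s' : ℕ} (hs : s < 4 * t + 3)
    (hs' : s' < 4 * t + 3) (h : columnCell n t l s = columnCell n t l' s') : l = l' ∧ s = s' := by
  unfold columnCell at h
  grind

omit [NeZero n] in
theorem entry_row (l : ZMod n) {s : ℕ} (hs : s < 4 * t + 3) :
    partialSum t (rowPair n t F l) (topEntry n t l) (lowEntry n t l)
        (if s + 1 = 4 * t + 3 then 0 else s + 1) -
      partialSum t (rowPair n t F l) (topEntry n t l) (lowEntry n t l) s = entry n t F l s := by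
  rw [partialSum_step _ _ _ _ hs]
  unfold entry absEntry
  split_ifs <;> first | omega | skip
  all_goals (unfold topEntry midEntry lowEntry; push_cast; omega)

omit [NeZero n] in
theorem entry_column (l : ZMod n) {s : ℕ} (hs : s < 4 * t + 3) :
    partialSum t (rowPair n t F l) (topEntry n t l) (columnLast n t l)
        (if s + 1 = 4 * t + 3 then 0 else s + 1) -
      partialSum t (rowPair n t F l) (topEntry n t l) (columnLast n t l) s =
      entry n t F (columnCell n t l s).1 (columnCell n t l s).2 := by
  rw [partialSum_step _ _ _ _ hs]
  by_cases h : s ≤ 4 * t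
  · rw [show columnCell n t l s = (l, s) from if_pos h]
    simp only [entry, absEntry]
    split_ifs <;> omega
  · have h' : s = 4 * t + 1 ∨ s = 4 * t + 2 := by omega
    rcases h' with rfl | rfl <;> by_cases h0 : l = 0
    · subst h0
      rw [show columnCell n t 0 (4 * t + 1) = (-1, 4 * t + 1) by simp [columnCell]]
      simp [columnLast, entry, absEntry, topEntry, midEntry, lowEntry]
      omega
    · rw [show columnCell n t l (4 * t + 1) = (l + 1, 4 * t + 2) by simp [columnCell, h0]]
      simp [columnLast, entry, absEntry, topEntry, midEntry, lowEntry, h0]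
      omega
    · subst h0
      rw [show columnCell n t 0 (4 * t + 2) = (1, 4 * t + 2) by simp [columnCell]]
      simp [columnLast, entry, absEntry, lowEntry]
    · rw [show columnCell n t l (4 * t + 2) = (l - 1, 4 * t + 1) by simp [columnCell, h0]]
      simp [columnLast, entry, absEntry, midEntry, h0]

end rows

/-! ### Labelling the displacements -/

section labelling
variable {n t : ℕ} [NeZero n] {F G : ZMod n → ℕ → ℕ}

omit [NeZero n] in
theorem natAbs_entry (l : ZMod n) (s : ℕ) : (entry n t F l s).natAbs = absEntry n t F l s := by
  unfold entry; split_ifs <;> simp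

/-- Entries are at most nk in absolute value, so their sums and differences are smaller than the
modulus. Two orders are allowed so that embeddings can be compared. -/
theorem absEntry_eq_of_entry_eq_or_neg (hn : n % 4 = 1) (ht : 1 ≤ t) (hnt : 28 * t + 22 ≤ 3 * n)
    (hF : IsPairOrder t F) (hG : IsPairOrder t G) {l l' : ZMod n} {s s' : ℕ}
    (h : (entry n t F l s : ZMod (2 * n * (4 * t + 3) + 1)) = entry n t G l' s' ∨
      (entry n t F l s : ZMod (2 * n * (4 * t + 3) + 1)) = -entry n t G l' s') :
    absEntry n t F l s = absEntry n t G l' s' := by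
  have h1 := absEntry_mem hn ht hnt hF l s
  have h2 := absEntry_mem hn ht hnt hG l' s'
  rw [← natAbs_entry] at h1 h2 ⊢
  rw [← natAbs_entry]
  rw [← Int.cast_neg, ZMod.intCast_eq_intCast_iff_dvd_sub, ZMod.intCast_eq_intCast_iff_dvd_sub,
    mul_assoc] at h
  generalize n * (4 * t + 3) = N at *
  rcases h with h | h
  all_goals
    have := Int.eq_zero_of_abs_lt_dvd h (by rw [abs_lt]; constructor <;> omega)
    omega

theorem entry_injective (hn : n % 4 = 1) (ht : 1 ≤ t) (hnt : 28 * t + 22 ≤ 3 * n)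
    (hF : IsPairOrder t F) {l l' : ZMod n} {s s' : ℕ} (hs : s < 4 * t + 3) (hs' : s' < 4 * t + 3)
    (h : (entry n t F l s : ZMod (2 * n * (4 * t + 3) + 1)) = entry n t F l' s') :
    l = l' ∧ s = s' :=
  absEntry_injective hn hF hs hs' (absEntry_eq_of_entry_eq_or_neg hn ht hnt hF hF (Or.inl h))

theorem entry_ne_neg (hn : n % 4 = 1) (ht : 1 ≤ t) (hnt : 28 * t + 22 ≤ 3 * n)
    (hF : IsPairOrder t F) {l l' : ZMod n} {s s' : ℕ} (hs : s < 4 * t + 3) (hs' : s' < 4 * t + 3) :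
    (entry n t F l s : ZMod (2 * n * (4 * t + 3) + 1)) ≠ -entry n t F l' s' := by
  intro h
  obtain ⟨rfl, rfl⟩ := absEntry_injective hn hF hs hs'
    (absEntry_eq_of_entry_eq_or_neg hn ht hnt hF hF (Or.inr h))
  have h1 := absEntry_mem hn ht hnt hF l s
  rw [← natAbs_entry] at h1
  rw [← Int.cast_neg, ZMod.intCast_eq_intCast_iff_dvd_sub, mul_assoc] at h
  generalize n * (4 * t + 3) = N at *
  -- The modulus is odd, so an entry equal to its own negative would vanish.
  have h2 : ((2 * N + 1 : ℕ) : ℤ) ∣ entry n t F l s := by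
    have : IsCoprime ((2 * N + 1 : ℕ) : ℤ) 2 := ⟨1, -N, by push_cast; ring⟩
    have h3 := (dvd_neg (α := ℤ)).2 h
    rw [show -(-entry n t F l s - entry n t F l s) = 2 * entry n t F l s by ring] at h3
    exact this.dvd_of_dvd_mul_left h3
  have := Int.eq_zero_of_abs_lt_dvd h2 (by rw [abs_lt]; constructor <;> omega)
  omega

theorem entry_ne_zero (hn : n % 4 = 1) (ht : 1 ≤ t) (hnt : 28 * t + 22 ≤ 3 * n)
    (hF : IsPairOrder t F) {l : ZMod n} {s : ℕ} (hs : s < 4 * t + 3) :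
    (entry n t F l s : ZMod (2 * n * (4 * t + 3) + 1)) ≠ 0 := by
  intro h
  exact entry_ne_neg hn ht hnt hF (l := l) (l' := l) hs hs (by rw [h, neg_zero])

/-- The vertices of the base faces: the row faces carry `false`, the column faces `true`. -/
def facePotential (n t : ℕ) (F : ZMod n → ℕ → ℕ) (b : Bool × ZMod n) (s : ZMod (4 * t + 3)) :
    ZMod (2 * n * (4 * t + 3) + 1) :=
  if b.1 then
    -(partialSum t (rowPair n t F b.2) (topEntry n t b.2) (columnLast n t b.2) s.val : ZMod _)
  else (partialSum t (rowPair n t F b.2) (topEntry n t b.2) (lowEntry n t b.2) s.val : ZMod _)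

/-- The displacement along the edge in position `z.2` of the base face `z.1`. -/
def displacement (n t : ℕ) (F : ZMod n → ℕ → ℕ) (z : (Bool × ZMod n) × ZMod (4 * t + 3)) :
    ZMod (2 * n * (4 * t + 3) + 1) :=
  facePotential n t F z.1 (z.2 + 1) - facePotential n t F z.1 z.2

/-- The successor of a position along a face. -/
def nextPos (t s : ℕ) : ℕ := if s + 1 = 4 * t + 3 then 0 else s + 1

theorem val_add_one (t : ℕ) (s : ZMod (4 * t + 3)) : (s + 1).val = nextPos t s.val := by
  have h := ZMod.val_lt s
  have h1 : (1 : ZMod (4 * t + 3)).val = 1 := by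
    have : Fact (1 < 4 * t + 3) := ⟨by omega⟩
    exact ZMod.val_one _
  rw [ZMod.val_add, h1, nextPos]
  split_ifs with h2
  · rw [h2, Nat.mod_self]
  · exact Nat.mod_eq_of_lt (by omega)

omit [NeZero n] in
theorem displacement_false (l : ZMod n) (s : ZMod (4 * t + 3)) :
    displacement n t F ((false, l), s) = entry n t F l s.val := by
  rw [← entry_row l (ZMod.val_lt s), Int.cast_sub]
  simp only [displacement, facePotential, val_add_one, nextPos]
  simp

omit [NeZero n] in
theorem displacement_true (l : ZMod n) (s : ZMod (4 * t + 3)) :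
    displacement n t F ((true, l), s) =
      -entry n t F (columnCell n t l s.val).1 (columnCell n t l s.val).2 := by
  rw [← entry_column l (ZMod.val_lt s), Int.cast_sub]
  simp only [displacement, facePotential, val_add_one, nextPos]
  simp only [if_true]
  ring

theorem facePotential_injective (hn : n % 4 = 1) (ht : 1 ≤ t) (hnt : 28 * t + 22 ≤ 3 * n)
    (hF : IsPairOrder t F) (b : Bool × ZMod n) : Function.Injective (facePotential n t F b) := by
  obtain ⟨b, l⟩ := b
  intro s s' h
  apply ZMod.val_injective
  unfold facePotential at h
  cases b
  · obtain ⟨h1, h2⟩ := lowEntry_mem (t := t) hn l l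
    exact partialSum_rowPair_injective hn ht hnt hF l h1 h2 (ZMod.val_lt s) (ZMod.val_lt s')
      (by simpa using h)
  · obtain ⟨h1, h2⟩ := columnLast_mem (t := t) hn l
    exact partialSum_rowPair_injective hn ht hnt hF l h1 h2 (ZMod.val_lt s) (ZMod.val_lt s')
      (by simpa using h)

theorem displacement_ne_zero (hn : n % 4 = 1) (ht : 1 ≤ t) (hnt : 28 * t + 22 ≤ 3 * n)
    (hF : IsPairOrder t F) (z : (Bool × ZMod n) × ZMod (4 * t + 3)) :
    displacement n t F z ≠ 0 := by
  obtain ⟨⟨b, l⟩, s⟩ := z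
  cases b
  · rw [displacement_false]
    exact entry_ne_zero hn ht hnt hF (ZMod.val_lt s)
  · rw [displacement_true, neg_ne_zero]
    exact entry_ne_zero hn ht hnt hF (columnCell_lt l (ZMod.val_lt s))

theorem displacement_injective (hn : n % 4 = 1) (ht : 1 ≤ t) (hnt : 28 * t + 22 ≤ 3 * n)
    (hF : IsPairOrder t F) : Function.Injective (displacement n t F) := by
  rintro ⟨⟨b, l⟩, s⟩ ⟨⟨b', l'⟩, s'⟩ h
  have hs := ZMod.val_lt s
  have hs' := ZMod.val_lt s'
  cases b <;> cases b' <;> simp only [displacement_false, displacement_true, neg_inj] at h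
  · obtain ⟨rfl, h2⟩ := entry_injective hn ht hnt hF hs hs' h
    rw [ZMod.val_injective _ h2]
  · exact absurd h (entry_ne_neg hn ht hnt hF hs (columnCell_lt l' hs'))
  · exact absurd h.symm (entry_ne_neg hn ht hnt hF hs' (columnCell_lt l hs))
  · have h1 := entry_injective hn ht hnt hF (columnCell_lt l hs) (columnCell_lt l' hs') h
    obtain ⟨rfl, h2⟩ := columnCell_injective hs hs' (Prod.ext h1.1 h1.2)
    rw [ZMod.val_injective _ h2]

/-- Every nonzero displacement occurs exactly once along the base faces. -/
noncomputable def displacementEquiv (hn : n % 4 = 1) (ht : 1 ≤ t) (hnt : 28 * t + 22 ≤ 3 * n)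
    (hF : IsPairOrder t F) : (Bool × ZMod n) × ZMod (4 * t + 3) ≃
      {a : ZMod (2 * n * (4 * t + 3) + 1) // a ≠ 0} :=
  Equiv.ofBijective (fun z => ⟨displacement n t F z, displacement_ne_zero hn ht hnt hF z⟩) (by
    rw [Fintype.bijective_iff_injective_and_card]
    refine ⟨fun z z' h => displacement_injective hn ht hnt hF (congrArg Subtype.val h), ?_⟩
    rw [Fintype.card_subtype_compl, Fintype.card_subtype_eq]
    simp [ZMod.card])

theorem displacementEquiv_apply (hn : n % 4 = 1) (ht : 1 ≤ t) (hnt : 28 * t + 22 ≤ 3 * n)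
    (hF : IsPairOrder t F) (z : (Bool × ZMod n) × ZMod (4 * t + 3)) :
    (displacementEquiv hn ht hnt hF z).1 = displacement n t F z := rfl

/-! ### The rotation is a single cycle -/

/-- A cycle with one link removed is still connected; the missing link at 0 leaves room for the
exceptional column. -/
theorem rel_of_rel_sub_one {α : Type*} {r : α → α → Prop} (hr : Equivalence r) (f : ZMod n → α)
    (h : ∀ u, u ≠ 0 → r (f u) (f (u - 1))) (u u' : ZMod n) : r (f u) (f u') := by
  have key : ∀ i : ℕ, i < n → r (f i) (f 0) := by
    intro i
    induction i with
    | zero => intro _; simpa using hr.refl _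
    | succ i ih =>
      intro hi
      have h1 : ((i + 1 : ℕ) : ZMod n) ≠ 0 := by
        rw [Ne, ZMod.natCast_eq_zero_iff]
        exact Nat.not_dvd_of_pos_of_lt (Nat.succ_pos i) hi
      have h2 := h _ h1
      rw [Nat.cast_succ, add_sub_cancel_right] at h2
      rw [Nat.cast_succ]
      exact hr.trans h2 (ih (by omega))
  have all : ∀ u : ZMod n, r (f u) (f 0) := by
    intro u
    have := key u.val (ZMod.val_lt u)
    rwa [ZMod.natCast_zmod_val] at this
  exact hr.trans (all u) (hr.symm (all u'))

/-- Alternating between successors in columns and in rows reaches all cells. -/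
theorem rel_cells (hn : n % 2 = 1) {r : ZMod n × ℕ → ZMod n × ℕ → Prop} (hr : Equivalence r)
    (h : ∀ l s, s < 4 * t + 3 → r (columnCell n t l s)
      ((columnCell n t l (nextPos t s)).1, nextPos t (columnCell n t l (nextPos t s)).2))
    (l l' : ZMod n) {s s' : ℕ} (hs : s < 4 * t + 3) (hs' : s' < 4 * t + 3) :
    r (l, s) (l', s') := by
  have c0 : ∀ l : ZMod n, ∀ s, s ≤ 4 * t → columnCell n t l s = (l, s) := fun l s hs => if_pos hs
  have c1 : ∀ l : ZMod n, l ≠ 0 → columnCell n t l (4 * t + 1) = (l + 1, 4 * t + 2) := by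
    intro l hl; simp [columnCell, hl]
  have c2 : ∀ l : ZMod n, l ≠ 0 → columnCell n t l (4 * t + 2) = (l - 1, 4 * t + 1) := by
    intro l hl; simp [columnCell, hl]
  have d1 : columnCell n t 0 (4 * t + 1) = (-1, 4 * t + 1) := by simp [columnCell]
  have d2 : columnCell n t 0 (4 * t + 2) = (1, 4 * t + 2) := by simp [columnCell]
  have n1 : ∀ s, s < 4 * t + 2 → nextPos t s = s + 1 := fun s hs => if_neg (by omega)
  have n2 : nextPos t (4 * t + 2) = 0 := if_pos rfl
  have two : ∀ l : ZMod n, ∀ s, s < 4 * t → r (l, s) (l, s + 2) := by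
    intro l s hs
    have := h l s (by omega)
    rwa [n1 s (by omega), c0 l s (by omega), c0 l (s + 1) (by omega), n1 _ (by omega)] at this
  have even : ∀ (l : ZMod n) (j : ℕ), j ≤ 2 * t → r (l, 0) (l, 2 * j) := by
    intro l j
    induction j with
    | zero => intro _; exact hr.refl _
    | succ j ih => intro hj; exact hr.trans (ih (by omega)) (two l (2 * j) (by omega))
  have odd : ∀ (l : ZMod n) (j : ℕ), j ≤ 2 * t → r (l, 1) (l, 2 * j + 1) := by
    intro l j
    induction j with
    | zero => intro _; exact hr.refl _
    | succ j ih => intro hj; exact hr.trans (ih (by omega)) (two l (2 * j + 1) (by omega))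
  have top : ∀ l : ZMod n, r (l, 4 * t) ((columnCell n t l (4 * t + 1)).1,
      nextPos t (columnCell n t l (4 * t + 1)).2) := by
    intro l
    have := h l (4 * t) (by omega)
    rwa [n1 _ (by omega), c0 l _ le_rfl] at this
  have mid : ∀ l : ZMod n, r (columnCell n t l (4 * t + 1)) ((columnCell n t l (4 * t + 2)).1,
      nextPos t (columnCell n t l (4 * t + 2)).2) := by
    intro l
    have := h l (4 * t + 1) (by omega)
    rwa [n1 _ (by omega)] at this
  have low : ∀ l : ZMod n, r (columnCell n t l (4 * t + 2)) (l, 1) := by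
    intro l
    have := h l (4 * t + 2) (by omega)
    rwa [n2, c0 l 0 (by omega), n1 0 (by omega)] at this
  have top' : ∀ l : ZMod n, r (l, 0) (l, 4 * t) := by
    intro l
    have := even l (2 * t) le_rfl
    rwa [show 2 * (2 * t) = 4 * t by ring] at this
  have odd' : ∀ l : ZMod n, r (l, 1) (l, 4 * t + 1) := by
    intro l
    have := odd l (2 * t) le_rfl
    rwa [show 2 * (2 * t) = 4 * t by ring] at this
  -- Columns other than 0 link the rows within each of three classes: even positions up to 4t, odd
  -- positions, and the last position.
  have E : ∀ l l' : ZMod n, r (l, 0) (l', 0) := by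
    intro l l'
    have := rel_of_rel_sub_one hr (fun u : ZMod n => (-u, 0)) (fun u hu => by
      have h1 := top (-u)
      rw [c1 _ (neg_ne_zero.2 hu), n2] at h1
      have h2 := hr.trans (top' (-u)) h1
      rwa [show -u + 1 = -(u - 1) by ring] at h2) (-l) (-l')
    simpa using this
  have O : ∀ l l' : ZMod n, r (l, 1) (l', 1) := by
    intro l l'
    have := rel_of_rel_sub_one hr (fun u : ZMod n => (-1 - u, 1)) (fun u hu => by
      have h1 := low (-u)
      rw [c2 _ (neg_ne_zero.2 hu), show -u - 1 = -1 - u by ring] at h1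
      have h2 := hr.trans (odd' (-1 - u)) h1
      rwa [show -u = -1 - (u - 1) by ring] at h2) (-1 - l) (-1 - l')
    simpa using this
  -- Here the links shift the row by 2, which generates all rows because `n` is odd.
  have P : ∀ l l' : ZMod n, r (l, 4 * t + 2) (l', 4 * t + 2) := by
    intro l l'
    have e : ∀ l : ZMod n, 1 + 2 * (((n / 2 : ℕ) : ZMod n) * (1 - l)) = l := by
      intro l; linear_combination (1 - l) * two_mul_half_cast hn
    have := rel_of_rel_sub_one hr (fun u : ZMod n => (1 + 2 * u, 4 * t + 2)) (fun u hu => by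
      have hu2 : 2 * u ≠ 0 := by
        intro h0
        apply hu
        linear_combination -((n / 2 : ℕ) : ZMod n) * h0 + u * two_mul_half_cast hn
      have h1 := mid (2 * u)
      rw [c1 _ hu2, c2 _ hu2, n1 _ (by omega)] at h1
      rwa [show 2 * u + 1 = 1 + 2 * u by ring, show 2 * u - 1 = 1 + 2 * (u - 1) by ring] at h1)
      (((n / 2 : ℕ) : ZMod n) * (1 - l)) (((n / 2 : ℕ) : ZMod n) * (1 - l'))
    simpa only [e] using this
  -- The swapped cells of column 0 join the three classes.
  have EP : r ((0 : ZMod n), 0) (-1, 4 * t + 2) := by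
    have h1 := top 0
    rw [d1, n1 _ (by omega)] at h1
    exact hr.trans (top' 0) h1
  have PO : r ((1 : ZMod n), 4 * t + 2) (0, 1) := by
    have h1 := low 0
    rwa [d2] at h1
  have all : ∀ (l : ZMod n) (s : ℕ), s < 4 * t + 3 → r (l, s) (0, 0) := by
    intro l s hs
    by_cases h1 : s = 4 * t + 2
    · subst h1
      exact hr.trans (P l (-1)) (hr.symm EP)
    · rcases Nat.even_or_odd' s with ⟨j, rfl | rfl⟩
      · exact hr.trans (hr.symm (even l j (by omega))) (E l 0)
      · exact hr.trans (hr.symm (odd l j (by omega))) (hr.trans (O l 0)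
          (hr.trans (hr.symm PO) (hr.trans (P 1 (-1)) (hr.symm EP))))
  exact hr.trans (all l s hs) (hr.symm (all l' s' hs'))

theorem facesRotation_sameCycle (hn : n % 4 = 1) (ht : 1 ≤ t) (hnt : 28 * t + 22 ≤ 3 * n)
    (hF : IsPairOrder t F) (a b : {a : ZMod (2 * n * (4 * t + 3) + 1) // a ≠ 0}) :
    (facesRotation (displacementEquiv hn ht hnt hF)).SameCycle a b := by
  set θ := displacementEquiv hn ht hnt hF
  set ρ := facesRotation θ
  have valc : ∀ s, s < 4 * t + 3 → (s : ZMod (4 * t + 3)).val = s := fun s hs =>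
    ZMod.val_natCast_of_lt hs
  have ρtrue : ∀ (l : ZMod n) (s : ZMod (4 * t + 3)), ρ (θ ((true, l), s)) =
      θ ((false, (columnCell n t l s.val).1), ((columnCell n t l s.val).2 : ZMod (4 * t + 3)) + 1) := by
    intro l s
    apply facesRotation_apply
    rw [displacementEquiv_apply, displacementEquiv_apply, displacement_true, displacement_false,
      valc _ (columnCell_lt l (ZMod.val_lt s))]
  have ρfalse : ∀ (l : ZMod n) (s : ZMod (4 * t + 3)),
      ρ (θ ((false, (columnCell n t l s.val).1), ((columnCell n t l s.val).2 : ZMod (4 * t + 3)))) =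
      θ ((true, l), s + 1) := by
    intro l s
    apply facesRotation_apply
    rw [displacementEquiv_apply, displacementEquiv_apply, displacement_true, displacement_false,
      valc _ (columnCell_lt l (ZMod.val_lt s)), neg_neg]
  have hr : Equivalence fun z z' : ZMod n × ℕ =>
      ρ.SameCycle (θ ((false, z.1), (z.2 : ZMod (4 * t + 3)))) (θ ((false, z'.1), (z'.2 : ZMod (4 * t + 3)))) :=
    ⟨fun z => Equiv.Perm.SameCycle.refl _ _, fun h => h.symm, fun h h' => h.trans h'⟩
  have cast_next : ∀ s, s < 4 * t + 3 → ((nextPos t s : ℕ) : ZMod (4 * t + 3)) = s + 1 := by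
    intro s hs
    apply ZMod.val_injective
    rw [val_add_one, valc s hs, valc]
    unfold nextPos; split_ifs <;> omega
  -- Two applications of `ρ` go from a cell to the next one in its column, then to the next one in
  -- that cell's row.
  have hcells := fun (l l' : ZMod n) {s s' : ℕ} (hs : s < 4 * t + 3) (hs' : s' < 4 * t + 3) =>
    rel_cells (n := n) (t := t) (by omega) hr (fun l s hs => by
      have h1 := ρfalse l s
      rw [valc s hs] at h1
      have h2 := ρtrue l (s + 1)
      rw [← h1, val_add_one, valc s hs] at h2
      have hlt : nextPos t s < 4 * t + 3 := by unfold nextPos; split_ifs <;> omega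
      simp only [cast_next _ (columnCell_lt l hlt)]
      rw [← h2]
      exact Equiv.Perm.sameCycle_apply_right.2
        (Equiv.Perm.sameCycle_apply_right.2 (Equiv.Perm.SameCycle.refl _ _))) l l' hs hs'
  have red : ∀ a, ∃ (l : ZMod n) (s : ZMod (4 * t + 3)), ρ.SameCycle a (θ ((false, l), s)) := by
    intro a
    obtain ⟨⟨⟨b, l⟩, s⟩, rfl⟩ := θ.surjective a
    cases b
    · exact ⟨l, s, Equiv.Perm.SameCycle.refl _ _⟩
    · have h1 : ρ.SameCycle (θ ((true, l), s)) (ρ (θ ((true, l), s))) :=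
        Equiv.Perm.sameCycle_apply_right.2 (Equiv.Perm.SameCycle.refl _ _)
      rw [ρtrue] at h1
      exact ⟨_, _, h1⟩
  obtain ⟨l, s, h1⟩ := red a
  obtain ⟨l', s', h2⟩ := red b
  have h3 := hcells l l' (ZMod.val_lt s) (ZMod.val_lt s')
  simp only [ZMod.natCast_zmod_val] at h3
  exact h1.trans (h3.trans h2.symm)

/-- The biembedding of the complete graph determined by the order of the pairs in each row. -/
noncomputable def pairOrderEmbedding (hn : n % 4 = 1) (ht : 1 ≤ t) (hnt : 28 * t + 22 ≤ 3 * n)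
    (hF : IsPairOrder t F) :
    CombEmbedding (⊤ : SimpleGraph (ZMod (2 * n * (4 * t + 3) + 1))) :=
  cyclicEmbedding (facesRotation (displacementEquiv hn ht hnt hF))
    (facesRotation_sameCycle hn ht hnt hF)

theorem pairOrderEmbedding_faces (hn : n % 4 = 1) (ht : 1 ≤ t) (hnt : 28 * t + 22 ≤ 3 * n)
    (hF : IsPairOrder t F) :
    (pairOrderEmbedding hn ht hnt hF).IsGonal (4 * t + 3) ∧
      (pairOrderEmbedding hn ht hnt hF).IsSimple ∧
      (pairOrderEmbedding hn ht hnt hF).IsBiembedding := by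
  refine cyclicEmbedding_faces _ (facePotential n t F) _ (fun b s => rfl)
    (facePotential_injective hn ht hnt hF) Prod.fst ?_
  rintro ⟨b, l⟩ s ⟨b', l'⟩ s' h rfl
  rw [displacementEquiv_apply, displacementEquiv_apply] at h
  have hs := ZMod.val_lt s
  have hs' := ZMod.val_lt s'
  cases b <;> simp only [displacement_false, displacement_true, neg_inj] at h
  · exact entry_ne_neg hn ht hnt hF hs hs' h
  · exact entry_ne_neg hn ht hnt hF (columnCell_lt l hs) (columnCell_lt l' hs') h

theorem pairOrder_eq_of_embedding_eq (hn : n % 4 = 1) (ht : 1 ≤ t) (hnt : 28 * t + 22 ≤ 3 * n)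
    (hF : IsPairOrder t F) (hG : IsPairOrder t G)
    (h : pairOrderEmbedding hn ht hnt hF = pairOrderEmbedding hn ht hnt hG) (l : ZMod n) {j : ℕ}
    (hj : j < 2 * t) : F l j = G l j := by
  have hρ := cyclicEmbedding_injective h
  -- Start at the last cell of the row, whose entry does not depend on the order; the rotation then
  -- determines the rest of the row.
  have key : ∀ i : ℕ, displacementEquiv hn ht hnt hF ((false, l), ((4 * t + 2 + i : ℕ) : ZMod (4 * t + 3))) =
      displacementEquiv hn ht hnt hG ((false, l), ((4 * t + 2 + i : ℕ) : ZMod (4 * t + 3))) := by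
    intro i
    induction i with
    | zero =>
      apply Subtype.ext
      rw [displacementEquiv_apply, displacementEquiv_apply, displacement_false, displacement_false,
        ZMod.val_natCast_of_lt (by omega)]
      simp [entry, absEntry]
    | succ i ih =>
      have h1 := facesRotation_apply (displacementEquiv hn ht hnt hF)
        ⟨-_, neg_ne_zero.2 (displacementEquiv hn ht hnt hF ((false, l), ((4 * t + 2 + i : ℕ) :
          ZMod (4 * t + 3)))).2⟩ _ _ rfl
      have h2 := facesRotation_apply (displacementEquiv hn ht hnt hG)
        ⟨-_, neg_ne_zero.2 (displacementEquiv hn ht hnt hF ((false, l), ((4 * t + 2 + i : ℕ) :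
          ZMod (4 * t + 3)))).2⟩ (false, l) ((4 * t + 2 + i : ℕ) : ZMod (4 * t + 3)) (by rw [ih])
      rw [hρ, h2] at h1
      rw [← add_assoc, Nat.cast_succ]
      exact h1.symm
  have h1 := congrArg Subtype.val (key (2 * j + 1))
  have e : ((4 * t + 2 + (2 * j + 1) : ℕ) : ZMod (4 * t + 3)) = ((2 * j : ℕ) : ZMod (4 * t + 3)) := by
    rw [show 4 * t + 2 + (2 * j + 1) = (4 * t + 3) + 2 * j by ring, Nat.cast_add, ZMod.natCast_self,
      zero_add]
  rw [e, displacementEquiv_apply, displacementEquiv_apply, displacement_false, displacement_false,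
    ZMod.val_natCast_of_lt (by omega)] at h1
  have h2 := absEntry_eq_of_entry_eq_or_neg hn ht hnt hF hG (Or.inl h1)
  unfold absEntry at h2
  rw [if_pos (by omega), if_pos (by omega), show 2 * j / 2 = j by omega] at h2
  obtain ⟨h3, -⟩ := pairStart_add_injective n t (by omega) (by omega) h2
  exact (mul_add_eq_mul_add_iff_of_lt (ZMod.val_lt l) (ZMod.val_lt l) h3).1

end labelling

/-! ### Counting -/

/-- The order of the pairs in each row given by permutations of the positive indices. -/
def pairOrder {n t : ℕ} [NeZero (2 * t)]
    (f : ZMod n → Equiv.Perm {j : Fin (2 * t) // j ≠ 0}) (l : ZMod n) (j : ℕ) : ℕ :=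
  if h : j < 2 * t then (Equiv.Perm.ofSubtype (f l) ⟨j, h⟩ : Fin (2 * t)) else 0

theorem isPairOrder_pairOrder {n t : ℕ} [NeZero (2 * t)]
    (f : ZMod n → Equiv.Perm {j : Fin (2 * t) // j ≠ 0}) : IsPairOrder t (pairOrder f) where
  zero l := by
    have h : 0 < 2 * t := Nat.pos_of_ne_zero (NeZero.ne _)
    rw [pairOrder, dif_pos h]
    have : (⟨0, h⟩ : Fin (2 * t)) = 0 := rfl
    rw [this, Equiv.Perm.ofSubtype_apply_of_not_mem _ (by simp)]
    rfl
  lt l j hj := by rw [pairOrder, dif_pos hj]; exact Fin.is_lt _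
  inj l i j hi hj h := by
    rw [pairOrder, pairOrder, dif_pos hi, dif_pos hj] at h
    simpa using (Equiv.Perm.ofSubtype (f l)).injective (Fin.ext h)

theorem pairOrder_injective {n t : ℕ} [NeZero (2 * t)]
    {f g : ZMod n → Equiv.Perm {j : Fin (2 * t) // j ≠ 0}}
    (h : ∀ l j, j < 2 * t → pairOrder f l j = pairOrder g l j) : f = g := by
  funext l
  apply Equiv.Perm.ofSubtype_injective
  ext j
  have := h l j j.2
  rw [pairOrder, pairOrder, dif_pos j.2, dif_pos j.2] at this
  exact this

theorem numDerangements_le_factorial (m : ℕ) : numDerangements m ≤ m ! := by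
  rw [← card_derangements_fin_eq_numDerangements]
  refine (Fintype.card_subtype_le _).trans ?_
  rw [Fintype.card_perm, Fintype.card_fin]

theorem pow_three_le_six_pow {n : ℕ} (hn : 4 ≤ n) : n ^ 3 ≤ 6 ^ (n - 1) := by
  induction n, hn using Nat.le_induction with
  | base => norm_num
  | succ n hn ih =>
    obtain ⟨m, rfl⟩ : ∃ m, n = m + 1 := ⟨n - 1, by omega⟩
    rw [Nat.add_sub_cancel] at ih ⊢
    calc (m + 1 + 1) ^ 3 ≤ (m + 1) ^ 3 * 6 := by nlinarith [Nat.mul_le_mul hn hn]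
      _ ≤ 6 ^ m * 6 := Nat.mul_le_mul_right _ ih

theorem two_mul_sub_two_mul_choose_two (n : ℕ) :
    2 * (n - 2) * n.choose 2 = n * (n - 1) * (n - 2) := by
  have h : n.choose 2 * 2 = n * (n - 1) := by
    rw [Nat.choose_two_right]
    exact Nat.div_mul_cancel (Nat.even_mul_pred_self n).two_dvd
  rw [← h]; ring

/-- The left side is at most n³ (t - 2)!². One factor (2t - 1)! absorbs (t - 2)!², and the other n -
1, each at least 6, absorb n³. -/
theorem biembeddingBound_le {n t : ℕ} (hn : 4 ≤ n) (ht : 2 ≤ t) :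
    biembeddingBound n t ≤ ((2 * t - 1)!) ^ n := by
  have h1 : (t - 2)! ^ 2 ≤ (2 * t - 1)! := by
    calc (t - 2)! ^ 2 = (t - 2)! * (t - 2)! := sq _
      _ ≤ (t - 2 + (t - 2))! := Nat.le_of_dvd (Nat.factorial_pos _)
          (Nat.factorial_mul_factorial_dvd_factorial_add _ _)
      _ ≤ _ := Nat.factorial_le (by omega)
  have h2 : 6 ≤ (2 * t - 1)! := Nat.factorial_le (show 3 ≤ 2 * t - 1 by omega)
  calc biembeddingBound n t = n * (n - 1) * (n - 2) * numDerangements (t - 2) ^ 2 := by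
        rw [biembeddingBound, two_mul_sub_two_mul_choose_two]
    _ ≤ n * n * n * (t - 2)! ^ 2 := by
        gcongr
        · omega
        · omega
        · exact numDerangements_le_factorial _
    _ = n ^ 3 * (t - 2)! ^ 2 := by ring
    _ ≤ 6 ^ (n - 1) * (2 * t - 1)! := Nat.mul_le_mul (pow_three_le_six_pow hn) h1
    _ ≤ (2 * t - 1)! ^ (n - 1) * (2 * t - 1)! := Nat.mul_le_mul_right _ (Nat.pow_le_pow_left h2 _)
    _ = (2 * t - 1)! ^ n := by rw [← pow_succ, Nat.sub_add_cancel (by omega)]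

theorem exists_biembeddings {n t : ℕ} (hn : n % 4 = 1) (ht : 2 ≤ t) (hnt : 28 * t + 22 ≤ 3 * n) :
    ∃ S : Finset (CombEmbedding (⊤ : SimpleGraph (ZMod (2 * n * (4 * t + 3) + 1)))),
      biembeddingBound n t ≤ S.card ∧
      ∀ E ∈ S, (E.IsGonal (4 * t + 3) ∧ E.IsSimple ∧ E.IsBiembedding) ∧
        ∀ g : ZMod (2 * n * (4 * t + 3) + 1), E.IsOrientationPreservingAut (translation g) := by
  have : NeZero n := ⟨by omega⟩
  have : NeZero (2 * t) := ⟨by omega⟩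
  have ht' : 1 ≤ t := by omega
  let f : (ZMod n → Equiv.Perm {j : Fin (2 * t) // j ≠ 0}) ↪
      CombEmbedding (⊤ : SimpleGraph (ZMod (2 * n * (4 * t + 3) + 1))) :=
    ⟨fun f => pairOrderEmbedding hn ht' hnt (isPairOrder_pairOrder f), fun f g h =>
      pairOrder_injective fun l j hj => pairOrder_eq_of_embedding_eq hn ht' hnt _ _ h l hj⟩
  refine ⟨Finset.univ.map f, ?_, ?_⟩
  · rw [Finset.card_map, Finset.card_univ, Fintype.card_fun, ZMod.card, Fintype.card_perm,
      Fintype.card_subtype_compl, Fintype.card_subtype_eq, Fintype.card_fin]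
    exact biembeddingBound_le (by omega) ht
  · intro E hE
    obtain ⟨f', -, rfl⟩ := Finset.mem_map.1 hE
    exact ⟨pairOrderEmbedding_faces hn ht' hnt _,
      cyclicEmbedding_translation _ (facesRotation_sameCycle hn ht' hnt _)⟩

/-! ### Asymptotics -/

/-- The ratio equals (1 - 1/n)(1 - 2/n) e² (D(t - 2)/(t - 2)!)². The filter only sends `t` to
infinity over admissible pairs, which encodes uniformity in `n`. -/
theorem tendsto_biembeddingBound_div :
    Tendsto
      (fun p : ℕ × ℕ =>
        (biembeddingBound p.1 p.2 : ℝ) /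
          ((p.1 : ℝ) ^ 3 * (((p.2 - 2)! : ℕ) : ℝ) ^ 2 / Real.exp 1 ^ 2))
      (comap Prod.snd atTop ⊓ 𝓟 {p : ℕ × ℕ | Admissible p.1 (4 * p.2 + 3) p.2})
      (𝓝 1) := by
  set l := comap (Prod.snd : ℕ × ℕ → ℕ) atTop ⊓
    𝓟 {p : ℕ × ℕ | Admissible p.1 (4 * p.2 + 3) p.2}
  have hadm : ∀ᶠ p : ℕ × ℕ in l, Admissible p.1 (4 * p.2 + 3) p.2 :=
    mem_inf_of_right (mem_principal_self _)
  have h2 : Tendsto (fun p : ℕ × ℕ => p.2) l atTop := tendsto_comap.mono_left inf_le_left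
  -- Admissibility forces `n ≥ t`.
  have h1 : Tendsto (fun p : ℕ × ℕ => p.1) l atTop := by
    refine tendsto_atTop_mono' l ?_ h2
    filter_upwards [hadm] with p hp
    obtain ⟨-, -, -, h, -⟩ := hp
    omega
  have hD := (numDerangements_tendsto_inv_e.comp ((tendsto_sub_atTop_nat 2).comp h2)).pow 2
  have hN := (tendsto_inv_atTop_nhds_zero_nat (𝕜 := ℝ)).comp h1
  have hlim := (((tendsto_const_nhds (x := (1 : ℝ))).sub hN).mul
    ((tendsto_const_nhds (x := (1 : ℝ))).sub (hN.const_mul 2))).mul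
      (hD.mul_const (Real.exp 1 ^ 2))
  have e : (1 - 0) * (1 - 2 * 0) * (Real.exp (-1) ^ 2 * Real.exp 1 ^ 2) = 1 := by
    rw [← mul_pow, ← Real.exp_add]; simp
  rw [e] at hlim
  refine hlim.congr' ?_
  filter_upwards [hadm] with p hp
  obtain ⟨h3, -, -, h4, -⟩ := hp
  obtain ⟨n, t⟩ := p
  simp only at h3 h4
  have hn : (n : ℝ) ≠ 0 := by
    have : n ≠ 0 := by omega
    exact_mod_cast this
  have hf : (((t - 2)! : ℕ) : ℝ) ≠ 0 := by exact_mod_cast Nat.factorial_ne_zero _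
  have he := (Real.exp_pos 1).ne'
  rw [biembeddingBound, two_mul_sub_two_mul_choose_two]
  simp only [Function.comp_apply, Nat.cast_mul, Nat.cast_pow, Nat.cast_sub (show 1 ≤ n by omega),
    Nat.cast_sub (show 2 ≤ n by omega), Nat.cast_one, Nat.cast_ofNat]
  field_simp

theorem mainTheorem9 :
    (∀ n k t : ℕ, Admissible n k t →
      ∃ S : Finset (CombEmbedding (⊤ : SimpleGraph (ZMod (2 * n * k + 1)))),
        biembeddingBound n t ≤ S.card ∧
        ∀ E ∈ S, (E.IsGonal k ∧ E.IsSimple ∧ E.IsBiembedding) ∧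
          ∀ g : ZMod (2 * n * k + 1), E.IsOrientationPreservingAut (translation g)) ∧
    Tendsto
      (fun p : ℕ × ℕ =>
        (biembeddingBound p.1 p.2 : ℝ) /
          ((p.1 : ℝ) ^ 3 * (((p.2 - 2)! : ℕ) : ℝ) ^ 2 / Real.exp 1 ^ 2))
      (comap Prod.snd atTop ⊓ 𝓟 {p : ℕ × ℕ | Admissible p.1 (4 * p.2 + 3) p.2})
      (𝓝 1) := by
  refine ⟨?_, tendsto_biembeddingBound_div⟩
  rintro n k t ⟨ht, rfl, hn, hnt, -⟩
  exact exists_biembeddings hn ht (by omega)
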